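/- For integers $a\ge 1$ and $n\ge 0$ let $$MO(a;n):=\sum s_1s_2\cdots s_a,$$ where the sum is over all partitions of $n$ with exactly $a$ distinct part sizes $0<k_1<k_2<\cdots<k_a$, the part $k_i$ being repeated $s_i\ge 1$ times (so $n=s_1k_1+\cdots+s_ak_a$). Equivalently, $MO(a;n)$ is the coefficient of $q^n$ in $$\sum_{0<k_1<k_2<\cdots<k_a}\frac{q^{k_1+k_2+\cdots+k_a}}{(1-q^{k_1})^2(1-q^{k_2})^2\cdots(1-q^{k_a})^2}.$$ Put $$N_2:=2^3,\quad N_3:=2^7\cdot 3\cdot 5,\quad N_4:=2^{10}\cdot 3^3\cdot 5\cdot 7,\quad N_5:=2^{15}\cdot 3^3\cdot 5^2\cdot 7,$$ and let $\mathrm{ord}_\ell(N)$ denote the exponent of the prime $\ell$ in the factorization of $N$. If $a\in\{2,3,4,5\}$, then the following are true. (i) If $\ell\in\{2,3,5,7\}$ and $p$ is a prime with $p\equiv -1\pmod{\ell^{\mathrm{ord}_\ell(N_a)+1}}$, then $MO(a;pn)\equiv 0\pmod{\ell}$ for every positive integer $n$ coprime to $p$. (ii) If $\ell\ge 11$ is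 prime and $p$ is a prime with $p\equiv -1\pmod{\ell}$, then $MO(a;pn)\equiv 0\pmod{\ell}$ for every positive integer $n$ coprime to $p$. -/

import Mathlib

/-- `MO a n` is the sum, over all partitions of `n` with exactly `a` distinct part sizes
`k₁ < ⋯ < kₐ` (where `kᵢ` is repeated `sᵢ ≥ 1` times), of the product `s₁ ⋯ sₐ` of the
multiplicities. -/
def MO (a n : ℕ) : ℕ :=
  ∑ P : n.Partition with P.parts.toFinset.card = a,
    ∏ k ∈ P.parts.toFinset, P.parts.count k

/-- The integers `N₂, N₃, N₄, N₅`; the value at any other index is never used. -/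
def macMahonN : ℕ → ℕ
  | 2 => 2 ^ 3
  | 3 => 2 ^ 7 * 3 * 5
  | 4 => 2 ^ 10 * 3 ^ 3 * 5 * 7
  | 5 => 2 ^ 15 * 3 ^ 3 * 5 ^ 2 * 7
  | _ => 1

/-! The generating function of `MO a` is the elementary symmetric function e_a of the series x_k =
q^k/(1-q^k)^2. Newton's identities (`mul_MOSeries`) express e_a through the power sums of the x_k,
whose n-th coefficients are divisor sums of an odd polynomial in d, hence rational combinations of
σ_k(n) with k odd (`factorial_mul_choose_eq_prod`). So e_a is a polynomial in E₂, E₄, E₆ of mixed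
weight at most 2a ≤ 10. Below weight 12 there are no cusp forms, and such quasimodular forms are
spanned by 1 and derivatives of Eisenstein series. Ramanujan's differential equations make this
explicit (`esymm_eq_of_ramanujan`): N_a · MO(a;n) is a sum of terms c_k(n) σ_k(n) with k ≤ 9 odd and
c_k an integral polynomial. If p ≡ -1 mod M and n is prime to p, then M divides 1 + p^k = σ_k(p),
hence σ_k(pn), for every odd k. Thus M divides N_a · MO(a;pn), and M = ℓ^(ord_ℓ(N_a)+1) forces ℓ to
divide MO(a;pn). -/

section ModularIdentities

/-! ### Expansions in q, their derivatives, and vanishing below weight 12. -/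

open UpperHalfPlane hiding I
open Real Complex Filter Function Derivative EisensteinSeries ModularForm
open scoped Manifold MatrixGroups ModularForm Topology PowerSeries

/-- Functions on the upper half plane given by a power series in `q = exp (2πiτ)` which converges
on the unit disc. -/
structure IsQSeries (f : ℍ → ℂ) : Prop where
  periodic : Periodic (f ∘ ofComplex) (1 : ℝ)
  mdiff : MDiff f
  bounded : IsBoundedAtImInfty f

namespace IsQSeries

variable {f g : ℍ → ℂ}

lemma analyticAt (hf : IsQSeries f) : AnalyticAt ℂ (cuspFunction 1 f) 0 :=
  analyticAt_cuspFunction_zero one_pos hf.periodic hf.mdiff hf.bounded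

lemma of_hasSum {c : ℕ → ℂ} (hf : MDiff f)
    (hc : ∀ τ : ℍ, HasSum (fun m ↦ c m • Periodic.qParam 1 τ ^ m) (f τ)) : IsQSeries f where
  periodic w := by
    by_cases! hw : 0 < im w
    · have hw' : 0 < im (w + (1 : ℝ)) := by simpa using hw
      have h := hc (ofComplex (w + (1 : ℝ)))
      have hq : Periodic.qParam 1 (ofComplex (w + (1 : ℝ)) : ℍ) =
          Periodic.qParam 1 (ofComplex w : ℍ) := by
        rw [ofComplex_apply_of_im_pos hw, ofComplex_apply_of_im_pos hw']
        simp [Periodic.qParam, mul_add, Complex.exp_add, Complex.exp_two_pi_mul_I]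
      rw [hq] at h
      exact h.unique (hc _)
    -- Off the upper half plane `ofComplex` takes a constant default value.
    · have hw' : im (w + (1 : ℝ)) ≤ 0 := by simpa using hw
      simp only [comp_apply, ofComplex_apply_of_im_nonpos hw, ofComplex_apply_of_im_nonpos hw']
  mdiff := hf
  bounded := isBoundedAtImInfty_of_hasSum_qExpansion one_pos hc

lemma qExpansion_eq_mk {c : ℕ → ℂ} (hf : MDiff f)
    (hc : ∀ τ : ℍ, HasSum (fun m ↦ c m • Periodic.qParam 1 τ ^ m) (f τ)) :
    qExpansion 1 f = PowerSeries.mk c := by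
  have hf' := (of_hasSum hf hc).analyticAt
  have h1 := (hasFPowerSeriesOnBall_cuspFunction one_pos hf' hc).hasFPowerSeriesAt
  ext m
  have := congr_arg (FormalMultilinearSeries.coeff · m)
    (hf'.hasFPowerSeriesAt.eq_formalMultilinearSeries h1)
  simpa [qExpansion_coeff, div_eq_mul_inv, mul_comm] using this

lemma mul (hf : IsQSeries f) (hg : IsQSeries g) : IsQSeries (f * g) where
  periodic := hf.periodic.mul hg.periodic
  mdiff := hf.mdiff.mul hg.mdiff
  bounded := hf.bounded.mul hg.bounded

lemma add (hf : IsQSeries f) (hg : IsQSeries g) : IsQSeries (f + g) where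
  periodic := hf.periodic.add hg.periodic
  mdiff := hf.mdiff.add hg.mdiff
  bounded := hf.bounded.add hg.bounded

lemma smul (a : ℂ) (hf : IsQSeries f) : IsQSeries (a • f) where
  periodic := hf.periodic.smul a
  mdiff := hf.mdiff.const_smul a
  bounded := hf.bounded.smul a

lemma of_modularForm {k : ℤ} (f : ModularForm 𝒮ℒ k) : IsQSeries f where
  periodic := SlashInvariantFormClass.periodic_comp_ofComplex f one_mem_strictPeriods_SL
  mdiff := f.holo'
  bounded := ModularFormClass.bdd_at_infty f

/-- With f(τ) = g(q), the chain rule turns (2πi)⁻¹ d/dτ into q d/dq, and the Taylor series of g' on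
the unit disc can be multiplied by q. -/
lemma hasSum_normalizedDeriv (hf : IsQSeries f) (τ : ℍ) :
    HasSum (fun m : ℕ ↦ ((m : ℂ) * (qExpansion 1 f).coeff m) • Periodic.qParam 1 τ ^ m)
      (D f τ) := by
  set g := cuspFunction 1 f with hg
  have hgd : DifferentiableOn ℂ g (Metric.ball 0 1) :=
    differentiableOn_cuspFunction_ball one_pos hf.periodic hf.mdiff hf.bounded
  set q := Periodic.qParam 1 (τ : ℂ) with hq
  have hq1 : q ∈ Metric.ball (0 : ℂ) 1 :=
    mem_ball_zero_iff.mpr (Periodic.norm_qParam_lt_one one_pos τ.im_pos)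
  have hD : D f τ = q * deriv g q := by
    have hev : f ∘ ofComplex =ᶠ[𝓝 (τ : ℂ)] fun w ↦ g (Periodic.qParam 1 w) := by
      filter_upwards [isOpen_upperHalfPlaneSet.mem_nhds τ.im_pos] with w hw
      have := eq_cuspFunction (ofComplex w) one_ne_zero hf.periodic
      rw [ofComplex_apply_of_im_pos hw] at this
      simpa [ofComplex_apply_of_im_pos hw] using this.symm
    have hqd : HasDerivAt (Periodic.qParam 1) (2 * π * I * q) (τ : ℂ) := by
      have h : HasDerivAt (fun w : ℂ ↦ cexp (2 * π * I * w / (1 : ℝ)))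
          (cexp (2 * π * I * τ / (1 : ℝ)) * (2 * π * I * 1 / (1 : ℝ))) (τ : ℂ) :=
        (((hasDerivAt_id _).const_mul _).div_const _).cexp
      convert! h using 1
      simp [hq, Periodic.qParam, mul_comm]
    have hgq : HasDerivAt g (deriv g q) q :=
      (hgd.differentiableAt (Metric.isOpen_ball.mem_nhds hq1)).hasDerivAt
    rw [normalizedDerivOfComplex, hev.deriv_eq,
      show deriv (fun w ↦ g (Periodic.qParam 1 w)) (τ : ℂ) = _ from (hgq.comp (τ : ℂ) hqd).deriv]
    field_simp [two_pi_I_ne_zero]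
  have hs := hasSum_taylorSeries_on_ball (hgd.deriv Metric.isOpen_ball) hq1
  rw [hD, ← hasSum_nat_add_iff' 1]
  convert! hs.mul_left q using 1
  · ext m
    simp only [sub_zero, smul_eq_mul, qExpansion_coeff, ← hg, iteratedDeriv_succ',
      Nat.factorial_succ]
    have h1 : ((m : ℂ) + 1) ≠ 0 := Nat.cast_add_one_ne_zero m
    have h2 : (m.factorial : ℂ) ≠ 0 := mod_cast m.factorial_ne_zero
    push_cast
    field_simp
    ring
  · simp

lemma normalizedDeriv (hf : IsQSeries f) : IsQSeries (D f) :=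
  of_hasSum (normalizedDerivOfComplex_mdifferentiable hf.mdiff) hf.hasSum_normalizedDeriv

end IsQSeries

/-- The derivation `X d/dX` of the ring of formal power series. -/
noncomputable def eulerDeriv : Derivation ℂ ℂ⟦X⟧ ℂ⟦X⟧ := (PowerSeries.X : ℂ⟦X⟧) • PowerSeries.derivative ℂ

lemma coeff_eulerDeriv (φ : ℂ⟦X⟧) (n : ℕ) :
    PowerSeries.coeff n (eulerDeriv φ) = n * PowerSeries.coeff n φ := by
  rcases n with _ | n
  · simp [eulerDeriv]
  · simp [eulerDeriv, PowerSeries.coeff_succ_X_mul, PowerSeries.coeff_derivative, mul_comm]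

lemma IsQSeries.qExpansion_normalizedDeriv {f : ℍ → ℂ} (hf : IsQSeries f) :
    qExpansion 1 (D f) = eulerDeriv (qExpansion 1 f) := by
  rw [qExpansion_eq_mk (normalizedDerivOfComplex_mdifferentiable hf.mdiff)
    hf.hasSum_normalizedDeriv]
  ext m
  rw [coeff_eulerDeriv, PowerSeries.coeff_mk]

/-- A level one form of weight less than twelve without constant term vanishes. -/
lemma IsQSeries.qExpansion_eq_zero {f : ℍ → ℂ} (hf : IsQSeries f) {k : ℕ} (hk : k < 12)
    (hinv : ∀ γ : SL(2, ℤ), f ∣[(k : ℤ)] γ = f) (h0 : (qExpansion 1 f).coeff 0 = 0) :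
    qExpansion 1 f = 0 := by
  let F : ModularForm 𝒮ℒ (k : ℤ) :=
    { toFun := f
      slash_action_eq' := by
        rintro _ ⟨γ, rfl⟩
        exact hinv γ
      holo' := hf.mdiff
      bdd_at_cusps' := by
        intro c hc
        rw [Subgroup.IsArithmetic.isCusp_iff_isCusp_SL2Z] at hc
        -- Every cusp is a translate of ∞, so invariance reduces boundedness to ∞.
        rw [OnePoint.isBoundedAt_iff_forall_SL2Z hc]
        intro γ _
        rw [hinv γ]
        exact hf.bounded }
  have hF : F = 0 := sturm_bound_levelOne_nat (by
    change _ < (qExpansion 1 f).order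
    rw [Nat.div_eq_of_lt hk, Nat.cast_zero, pos_iff_ne_zero,
      PowerSeries.order_ne_zero_iff_constCoeff_eq_zero]
    simpa using h0)
  have : f = 0 := congrArg DFunLike.coe hF
  rw [this, qExpansion_zero]

end ModularIdentities

/-! ### Ramanujan's identities and the Eisenstein series of weights 8 and 10. -/

section ModularIdentities

open UpperHalfPlane hiding I
open Real Complex Filter Function Derivative EisensteinSeries ModularForm
open scoped Manifold MatrixGroups ModularForm Topology PowerSeries ArithmeticFunction.sigma

/-- The power series `∑ σ_k(n) Xⁿ`. -/
noncomputable def sigmaSeries (k : ℕ) : ℂ⟦X⟧ := .mk fun n ↦ (σ k n : ℂ)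

lemma isQSeries_E2 : IsQSeries E2 :=
  .of_hasSum E2_mdifferentiable fun τ ↦ by
    simpa only [Periodic.qParam, ofReal_one, div_one] using hasSum_qExpansion_E2 (z := τ)

lemma qExpansion_E2 : qExpansion 1 E2 = 1 - (24 : ℂ) • sigmaSeries 1 := by
  rw [IsQSeries.qExpansion_eq_mk E2_mdifferentiable fun τ ↦ by
    simpa only [Periodic.qParam, ofReal_one, div_one] using hasSum_qExpansion_E2 (z := τ)]
  ext m
  rcases eq_or_ne m 0 with rfl | hm
  · simp [sigmaSeries]
  · simp [sigmaSeries, hm, PowerSeries.coeff_one]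

lemma qExpansion_E {k : ℕ} (hk : 3 ≤ k) (hk2 : Even k) :
    qExpansion 1 (E hk) = 1 + (-(2 * k / bernoulli k) : ℂ) • sigmaSeries (k - 1) := by
  ext m
  rw [E_qExpansion_coeff hk hk2]
  rcases eq_or_ne m 0 with rfl | hm
  · simp [sigmaSeries]
  · simp [sigmaSeries, hm, PowerSeries.coeff_one]

lemma serreDerivative_eq_add (k : ℂ) (f : ℍ → ℂ) :
    serreDerivative k f = D f + (-(k / 12)) • (E2 * f) := by
  ext z
  simp only [serreDerivative_apply, Pi.add_apply, Pi.smul_apply, Pi.mul_apply, smul_eq_mul]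
  ring

namespace IsQSeries

variable {f g : ℍ → ℂ}

lemma qExpansion_add_smul (hf : IsQSeries f) (hg : IsQSeries g) (a : ℂ) :
    qExpansion 1 (f + a • g) = qExpansion 1 f + a • qExpansion 1 g := by
  rw [qExpansion_add hf.analyticAt (hg.smul a).analyticAt, qExpansion_smul hg.analyticAt]

lemma serreDerivative (hf : IsQSeries f) (k : ℂ) : IsQSeries (serreDerivative k f) := by
  rw [serreDerivative_eq_add]
  exact hf.normalizedDeriv.add ((isQSeries_E2.mul hf).smul _)

lemma qExpansion_serreDerivative (hf : IsQSeries f) (k : ℂ) :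
    qExpansion 1 (Derivative.serreDerivative k f) =
      eulerDeriv (qExpansion 1 f) - (k / 12) • (qExpansion 1 E2 * qExpansion 1 f) := by
  rw [serreDerivative_eq_add, hf.normalizedDeriv.qExpansion_add_smul (isQSeries_E2.mul hf),
    hf.qExpansion_normalizedDeriv, qExpansion_mul isQSeries_E2.analyticAt hf.analyticAt]
  module

/-- Two level one forms of the same weight less than twelve are proportional. -/
lemma qExpansion_eq_smul (hf : IsQSeries f) (hg : IsQSeries g) {k : ℕ} (hk : k < 12)
    (hfk : ∀ γ : SL(2, ℤ), f ∣[(k : ℤ)] γ = f) (hgk : ∀ γ : SL(2, ℤ), g ∣[(k : ℤ)] γ = g) (a : ℂ)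
    (h0 : (qExpansion 1 f).coeff 0 = a * (qExpansion 1 g).coeff 0) :
    qExpansion 1 f = a • qExpansion 1 g := by
  have h := (hf.add (hg.smul (-a))).qExpansion_eq_zero hk
    (fun γ ↦ by rw [SlashAction.add_slash, SL_smul_slash, hfk, hgk])
    (by rw [hf.qExpansion_add_smul hg, map_add, PowerSeries.coeff_smul, h0, smul_eq_mul]; ring)
  rw [hf.qExpansion_add_smul hg] at h
  rw [eq_neg_of_add_eq_zero_left h]
  module

end IsQSeries

lemma ModularForm.slash_SL_eq {k : ℤ} (f : ModularForm 𝒮ℒ k) (γ : SL(2, ℤ)) : (⇑f) ∣[k] γ = ⇑f :=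
  f.slash_action_eq' _ ⟨γ, rfl⟩

lemma hasDerivAt_D2 (γ : SL(2, ℤ)) (z : ℍ) :
    HasDerivAt (D2 γ ∘ ofComplex) (-(2 * π * I)⁻¹ * D2 γ z ^ 2) (z : ℂ) := by
  have h := (hasDerivAt_denom_zpow (γ : GL (Fin 2) ℝ) (-1) z).const_mul (2 * π * I * γ 1 0)
  have hz := denom_ne_zero (γ : GL (Fin 2) ℝ) z
  have hev : D2 γ ∘ ofComplex =ᶠ[𝓝 (z : ℂ)]
      fun w ↦ 2 * π * I * γ 1 0 * denom (γ : GL (Fin 2) ℝ) w ^ (-1 : ℤ) := by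
    filter_upwards [isOpen_upperHalfPlaneSet.mem_nhds z.im_pos] with w hw
    simp [D2, ofComplex_apply_of_im_pos hw, div_eq_mul_inv]
  convert! h.congr_of_eventuallyEq hev using 1
  have hI := two_pi_I_ne_zero
  simp only [D2, zpow_sub₀ hz]
  field_simp
  simp [sq]

lemma mdifferentiable_D2 (γ : SL(2, ℤ)) : MDiff (D2 γ) := fun z ↦
  mdifferentiableAt_iff.mpr (hasDerivAt_D2 γ z).differentiableAt

/-- Both D E₂ and E₂² fail to be modular by terms in `D2 γ`. With the factor 1/12, which is the
Serre derivative of index 1 and not 2, these terms cancel. -/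
lemma serreDerivative_E2_slash (γ : SL(2, ℤ)) :
    Derivative.serreDerivative 1 E2 ∣[((4 : ℕ) : ℤ)] γ = Derivative.serreDerivative 1 E2 := by
  ext z
  have hI := two_pi_I_ne_zero
  have hD : D (E2 ∣[(2 : ℤ)] γ) z = (D E2 ∣[(4 : ℤ)] γ) z - 2 * (2 * π * I)⁻¹ ^ 2 *
      D2 γ z * (E2 ∣[(2 : ℤ)] γ) z := by
    have := congrFun (normalizedDerivOfComplex_SL_slash (k := 2) E2_mdifferentiable (γ := γ)) z
    rw [this]
    simp [D2]
    field_simp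
    rw [pow_succ, I_sq]
    ring
  have hE : E2 ∣[(2 : ℤ)] γ = E2 - (1 / (2 * riemannZeta 2)) • D2 γ := E2_slash_action γ
  have hDD : D ((1 / (2 * riemannZeta 2)) • D2 γ) z =
      (1 / (2 * riemannZeta 2)) * ((2 * π * I)⁻¹ * (-(2 * π * I)⁻¹ * D2 γ z ^ 2)) := by
    rw [normalizedDerivOfComplex_smul _ _ (mdifferentiable_D2 γ), Pi.smul_apply, smul_eq_mul,
      normalizedDerivOfComplex, (hasDerivAt_D2 γ z).deriv]
  have hmul : ((E2 * E2) ∣[(4 : ℤ)] γ) z = (E2 ∣[(2 : ℤ)] γ) z * (E2 ∣[(2 : ℤ)] γ) z :=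
    congrFun (ModularForm.mul_slash_SL2 2 2 γ E2 E2) z
  have hL : (Derivative.serreDerivative 1 E2 ∣[((4 : ℕ) : ℤ)] γ) z =
      (D E2 ∣[(4 : ℤ)] γ) z - 1 / 12 * ((E2 * E2) ∣[(4 : ℤ)] γ) z := by
    rw [serreDerivative_eq_add, SlashAction.add_slash, SL_smul_slash]
    simp
    ring
  rw [hL, hmul, serreDerivative_apply]
  rw [hE, normalizedDerivOfComplex_sub _ _ E2_mdifferentiable
    ((mdifferentiable_D2 γ).const_smul _), Pi.sub_apply, hDD] at hD
  rw [hE]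
  simp only [Pi.sub_apply, Pi.smul_apply, smul_eq_mul, riemannZeta_two] at hD ⊢
  -- The constant 1/(2ζ(2)) in the law for E₂, written in powers of 2πi so that the cancellation
  -- becomes linear algebra.
  have hκ : 1 / (2 * ((π : ℂ) ^ 2 / 6)) = -12 * (2 * π * I)⁻¹ ^ 2 := by
    have hpi : (π : ℂ) ≠ 0 := ofReal_ne_zero.mpr pi_ne_zero
    field_simp
    rw [I_sq]
    norm_num
  rw [hκ] at hD ⊢
  linear_combination -hD

/-- Ramanujan's identity for the derivative of `E₂`. -/
lemma eulerDeriv_E2 : eulerDeriv (qExpansion 1 E2) =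
    (1 / 12 : ℂ) • (qExpansion 1 E2 * qExpansion 1 E2 - qExpansion 1 E₄) := by
  have h := (isQSeries_E2.serreDerivative 1).qExpansion_eq_smul (.of_modularForm E₄) (k := 4)
    (by norm_num) serreDerivative_E2_slash (E₄.slash_SL_eq) (-1 / 12) (by
      rw [isQSeries_E2.qExpansion_serreDerivative, map_sub, coeff_eulerDeriv,
        E_qExpansion_coeff_zero _ ⟨2, rfl⟩, qExpansion_E2]
      simp [sigmaSeries]
      norm_num)
  rw [isQSeries_E2.qExpansion_serreDerivative] at h
  rw [eq_add_of_sub_eq h]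
  module

/-- Ramanujan's identity for the derivative of `E₄`. -/
lemma eulerDeriv_E4 : eulerDeriv (qExpansion 1 E₄) =
    (1 / 3 : ℂ) • (qExpansion 1 E2 * qExpansion 1 E₄ - qExpansion 1 E₆) := by
  have hE := IsQSeries.of_modularForm E₄
  have h := (hE.serreDerivative 4).qExpansion_eq_smul (.of_modularForm E₆) (k := 6)
    (by norm_num) (fun γ ↦ serreDerivative_slash_invariant hE.mdiff (E₄.slash_SL_eq γ))
    (E₆.slash_SL_eq) (-1 / 3) (by
      rw [hE.qExpansion_serreDerivative, map_sub, coeff_eulerDeriv,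
        E_qExpansion_coeff_zero _ ⟨3, rfl⟩, qExpansion_E2, qExpansion_E _ ⟨2, rfl⟩]
      simp [sigmaSeries]
      norm_num)
  rw [hE.qExpansion_serreDerivative] at h
  rw [eq_add_of_sub_eq h]
  module

/-- Ramanujan's identity for the derivative of `E₆`. -/
lemma eulerDeriv_E6 : eulerDeriv (qExpansion 1 E₆) =
    (1 / 2 : ℂ) • (qExpansion 1 E2 * qExpansion 1 E₆ - qExpansion 1 E₄ * qExpansion 1 E₄) := by
  have hE := IsQSeries.of_modularForm E₆
  have hE4 := IsQSeries.of_modularForm E₄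
  have h := (hE.serreDerivative 6).qExpansion_eq_smul (.of_modularForm (E₄.mul E₄)) (k := 8)
    (by norm_num) (fun γ ↦ serreDerivative_slash_invariant hE.mdiff (E₆.slash_SL_eq γ))
    ((E₄.mul E₄).slash_SL_eq) (-1 / 2) (by
      rw [hE.qExpansion_serreDerivative, map_sub, coeff_eulerDeriv,
        ModularForm.qExpansion_mul one_pos one_mem_strictPeriods_SL,
        qExpansion_E2, qExpansion_E _ ⟨2, rfl⟩, qExpansion_E _ ⟨3, rfl⟩]
      simp [sigmaSeries]
      norm_num)
  rw [hE.qExpansion_serreDerivative,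
    ModularForm.qExpansion_mul one_pos one_mem_strictPeriods_SL] at h
  rw [eq_add_of_sub_eq h]
  module

/-- Both sides have weight 8 < 12 and constant term 1. -/
lemma E8_eq : qExpansion 1 (E (by norm_num : 3 ≤ 8)) = qExpansion 1 E₄ * qExpansion 1 E₄ := by
  have h := (IsQSeries.of_modularForm (E (by norm_num : 3 ≤ 8))).qExpansion_eq_smul
    (.of_modularForm (E₄.mul E₄)) (k := 8) (by norm_num) (ModularForm.slash_SL_eq _)
    ((E₄.mul E₄).slash_SL_eq) 1 (by
      rw [ModularForm.qExpansion_mul one_pos one_mem_strictPeriods_SL,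
        qExpansion_E _ ⟨2, rfl⟩, qExpansion_E _ ⟨4, rfl⟩]
      simp [sigmaSeries])
  rwa [ModularForm.qExpansion_mul one_pos one_mem_strictPeriods_SL, one_smul] at h

lemma E10_eq : qExpansion 1 (E (by norm_num : 3 ≤ 10)) = qExpansion 1 E₄ * qExpansion 1 E₆ := by
  have h := (IsQSeries.of_modularForm (E (by norm_num : 3 ≤ 10))).qExpansion_eq_smul
    (.of_modularForm (E₄.mul E₆)) (k := 10) (by norm_num) (ModularForm.slash_SL_eq _)
    ((E₄.mul E₆).slash_SL_eq) 1 (by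
      rw [ModularForm.qExpansion_mul one_pos one_mem_strictPeriods_SL,
        qExpansion_E _ ⟨2, rfl⟩, qExpansion_E _ ⟨3, rfl⟩, qExpansion_E _ ⟨5, rfl⟩]
      simp [sigmaSeries])
  rwa [ModularForm.qExpansion_mul one_pos one_mem_strictPeriods_SL, one_smul] at h

end ModularIdentities

/-! ### Elementary symmetric functions, power sums and Newton's identities. -/

section GeneratingFunction

open scoped PowerSeries PowerSeries.WithPiTopology ArithmeticFunction.sigma Polynomial
open PowerSeries Finset

/-- The power series `q^k / (1 - q^k)² = ∑ m q^(km)` for `k = i + 1`. -/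
noncomputable def partSeries (i : ℕ) : ℂ⟦X⟧ :=
  expand (i + 1) i.succ_ne_zero (.mk fun m ↦ (m : ℂ))

/-- The generating function of `MO a`. -/
noncomputable def MOSeries (a : ℕ) : ℂ⟦X⟧ := .mk fun n ↦ (MO a n : ℂ)

/-- The power sums of the series `q^k / (1 - q^k)²`. -/
noncomputable def powerSumSeries (r : ℕ) : ℂ⟦X⟧ :=
  .mk fun n ↦ ∑ d ∈ n.divisors, ((d + r - 1).choose (2 * r - 1) : ℂ)

/-- The series is X/(1-X)², so its r-th power is X^r (1-X)^(-2r). For m < r the binomial coefficient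
vanishes, as it should. -/
lemma coeff_mk_natCast_pow {r : ℕ} (hr : 0 < r) (m : ℕ) :
    coeff m ((.mk fun m ↦ (m : ℂ) : ℂ⟦X⟧) ^ r) = ((m + r - 1).choose (2 * r - 1) : ℂ) := by
  have h1 : (.mk fun m ↦ (m : ℂ) : ℂ⟦X⟧) = X * (PowerSeries.mk 1) ^ 2 := by
    rw [mk_one_pow_eq_mk_choose_add]
    ext m
    rcases m with _ | m
    · simp
    · rw [coeff_succ_X_mul]
      simp [add_comm]
  have hd : 2 * r = 2 * r - 1 + 1 := by omega
  rw [h1, mul_pow, ← pow_mul, hd, mk_one_pow_eq_mk_choose_add, coeff_X_pow_mul']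
  split_ifs with h
  · rw [coeff_mk]
    congr 2
    omega
  · rw [Nat.choose_eq_zero_of_lt (by omega), Nat.cast_zero]

/-- Only part sizes dividing m contribute, so a finite set of indices already gives the coefficient
of the infinite sum. -/
lemma coeff_sum_partSeries_pow {r : ℕ} (hr : 0 < r) {m : ℕ} {s : Finset ℕ} (hs : range m ⊆ s) :
    coeff m (∑ i ∈ s, partSeries i ^ r) = coeff m (powerSumSeries r) := by
  have h (i : ℕ) : coeff m (partSeries i ^ r) =
      if i + 1 ∣ m then ((m / (i + 1) + r - 1).choose (2 * r - 1) : ℂ) else 0 := by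
    rw [partSeries, ← map_pow, coeff_expand, coeff_mk_natCast_pow hr]
  rw [map_sum, sum_congr rfl fun i _ ↦ h i, powerSumSeries, coeff_mk,
    ← Nat.sum_div_divisors m fun d ↦ ((d + r - 1).choose (2 * r - 1) : ℂ)]
  rcases Nat.eq_zero_or_pos m with rfl | hm
  · have : (r - 1).choose (2 * r - 1) = 0 := Nat.choose_eq_zero_of_lt (by omega)
    simp [this]
  rw [← sum_filter]
  refine sum_bij (fun i _ ↦ i + 1) ?_ ?_ ?_ ?_
  · intro i hi
    exact Nat.mem_divisors.mpr ⟨(mem_filter.mp hi).2, hm.ne'⟩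
  · intro i _ j _ h
    omega
  · intro d hd
    have hd0 := Nat.pos_of_mem_divisors hd
    have hdm := Nat.divisor_le hd
    refine ⟨d - 1, mem_filter.mpr ⟨hs (mem_range.mpr (by omega)), ?_⟩, by omega⟩
    rw [Nat.sub_add_cancel hd0]
    exact Nat.dvd_of_mem_divisors hd
  · intros
    rfl

lemma hasSum_partSeries {R : Type*} [CommRing R] [Algebra ℂ R] [TopologicalSpace R] (t : R)
    (i : ℕ) : HasSum (fun j ↦ ((j + 1 : ℕ) • t) • (X : R⟦X⟧) ^ ((i + 1) * (j + 1)))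
      (C t * map (algebraMap ℂ R) (partSeries i)) := by
  rw [PowerSeries.WithPiTopology.hasSum_iff_hasSum_coeff]
  intro m
  simp only [coeff_C_mul, coeff_map, partSeries, coeff_expand, coeff_mk, coeff_smul, coeff_X_pow]
  by_cases hm : ∃ j, m = (i + 1) * (j + 1)
  · obtain ⟨j, rfl⟩ := hm
    convert hasSum_single j ?_ using 1
    · simp [mul_comm]
    · intro j' hj'
      simp [hj'.symm]
  · push Not at hm
    convert hasSum_zero using 1
    · funext j
      simp [hm j]
    · split_ifs with h
      · obtain ⟨_ | j, rfl⟩ := h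
        · simp
        · exact absurd rfl (hm j)
      · simp

lemma coeff_toFinsupp_prod (n a : ℕ) (p : n.Partition) :
    (p.parts.toFinsupp.prod fun _ c ↦ c • (Polynomial.X : ℂ[X])).coeff a =
      if #p.parts.toFinset = a then ((∏ k ∈ p.parts.toFinset, p.parts.count k : ℕ) : ℂ) else 0 := by
  simp only [Finsupp.prod, Multiset.toFinsupp_support, Multiset.toFinsupp_apply,
    nsmul_eq_mul, prod_mul_distrib, prod_const]
  rw [← Nat.cast_prod, ← Polynomial.C_eq_natCast, Polynomial.coeff_C_mul, Polynomial.coeff_X_pow]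
  simp [eq_comm]

/-- For all sufficiently large sets of part sizes, the elementary symmetric functions of the
series `q^k / (1 - q^k)²` have the coefficients `MO a n`. -/
lemma exists_coeff_esymm_eq (n : ℕ) : ∃ s₀ : Finset ℕ, ∀ s, s₀ ⊆ s → ∀ a,
    coeff n (∑ A ∈ s.powersetCard a, ∏ i ∈ A, partSeries i) = (MO a n : ℂ) := by
  -- In the discrete topology, convergence of a coefficient means that it is eventually constant.
  let : TopologicalSpace ℂ[X] := ⊥
  have : DiscreteTopology ℂ[X] := ⟨rfl⟩
  -- The weight c·X of a part of multiplicity c makes the power of X count the distinct part sizes;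
  -- the product is ∏ (1 + X·x_k).
  have hp := Nat.Partition.hasProd_genFun (fun _ c ↦ c • (Polynomial.X : ℂ[X]))
  have ht := ((PowerSeries.WithPiTopology.continuous_coeff ℂ[X] n).tendsto _).comp hp
  rw [nhds_discrete, Filter.tendsto_pure] at ht
  obtain ⟨s₀, hs₀⟩ := Filter.eventually_atTop.mp ht
  refine ⟨s₀, fun s hs a ↦ ?_⟩
  have h := congrArg (Polynomial.coeff · a) (hs₀ s hs)
  simp only [Function.comp_apply, (hasSum_partSeries _ _).tsum_eq, Nat.Partition.coeff_genFun,
    Polynomial.finsetSum_coeff, coeff_toFinsupp_prod, prod_one_add, prod_mul_distrib,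
    prod_const, ← map_prod, ← map_pow, map_sum, coeff_C_mul, coeff_map] at h
  rw [MO, sum_filter, Nat.cast_sum]
  simp only [Nat.cast_ite, Nat.cast_zero]
  rw [← h, map_sum, powersetCard_eq_filter, sum_filter]
  refine sum_congr rfl fun A _ ↦ ?_
  rw [mul_comm, Polynomial.algebraMap_eq, Polynomial.coeff_C_mul, Polynomial.coeff_X_pow]
  simp [eq_comm]

/-- Newton's identities for finite families. -/
lemma mul_sum_powersetCard_prod {R ι : Type*} [CommRing R] (s : Finset ι) (f : ι → R)
    (a : ℕ) :
    a * ∑ A ∈ s.powersetCard a, ∏ i ∈ A, f i = (-1) ^ (a + 1) *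
      ∑ b ∈ antidiagonal a with b.1 < a, (-1) ^ b.1 *
        (∑ A ∈ s.powersetCard b.1, ∏ i ∈ A, f i) * ∑ i ∈ s, f i ^ b.2 := by
  classical
  have h := congrArg (MvPolynomial.aeval fun i : s ↦ f i) (MvPolynomial.mul_esymm_eq_sum s ℤ a)
  have hs : (univ : Finset s).val.map (fun i : s ↦ f i) = s.val.map f := by
    rw [univ_eq_attach, attach_val]
    exact Multiset.attach_map_val' _ f
  have hs' (k : ℕ) : ∑ i : s, f i ^ k = ∑ i ∈ s, f i ^ k := sum_coe_sort s fun i ↦ f i ^ k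
  simpa only [map_mul, map_pow, map_neg, map_one, map_sum, map_natCast, MvPolynomial.psum,
    MvPolynomial.aeval_X, MvPolynomial.aeval_esymm_eq_multiset_esymm, hs, esymm_map_val,
    hs'] using h

lemma coeff_mul_congr {R : Type*} [Semiring R] {n : ℕ} {φ φ' ψ ψ' : R⟦X⟧}
    (hφ : ∀ m ≤ n, coeff m φ = coeff m φ') (hψ : ∀ m ≤ n, coeff m ψ = coeff m ψ') :
    ∀ m ≤ n, coeff m (φ * ψ) = coeff m (φ' * ψ') := by
  intro m hm
  rw [coeff_mul, coeff_mul]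
  refine sum_congr rfl fun c hc ↦ ?_
  have hc' := mem_antidiagonal.mp hc
  rw [hφ _ (by omega), hψ _ (by omega)]

/-- Newton's identities for the generating functions `MOSeries`. -/
lemma mul_MOSeries (a : ℕ) : a * MOSeries a = (-1) ^ (a + 1) *
    ∑ b ∈ antidiagonal a with b.1 < a, (-1) ^ b.1 * MOSeries b.1 * powerSumSeries b.2 := by
  ext n
  choose s₀ hs₀ using exists_coeff_esymm_eq
  -- One finite index set that computes all coefficients up to n, both of the e_b and of the power
  -- sums.
  set s := range n ∪ (range (n + 1)).biUnion s₀
  have hE (m : ℕ) (hm : m ≤ n) (b : ℕ) :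
      coeff m (∑ A ∈ s.powersetCard b, ∏ i ∈ A, partSeries i) = coeff m (MOSeries b) := by
    rw [MOSeries, coeff_mk]
    exact hs₀ m s ((subset_biUnion_of_mem s₀ (mem_range.mpr (by omega))).trans
      subset_union_right) b
  have hP (m : ℕ) (hm : m ≤ n) (r : ℕ) (hr : 0 < r) :
      coeff m (∑ i ∈ s, partSeries i ^ r) = coeff m (powerSumSeries r) :=
    coeff_sum_partSeries_pow hr ((range_subset_range.mpr hm).trans subset_union_left)
  rw [← coeff_mul_congr (fun _ _ ↦ rfl) (fun m hm ↦ hE m hm a) n le_rfl,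
    mul_sum_powersetCard_prod s partSeries a]
  refine coeff_mul_congr (fun _ _ ↦ rfl) (fun m hm ↦ ?_) n le_rfl
  rw [map_sum, map_sum]
  refine sum_congr rfl fun b hb ↦ ?_
  obtain ⟨hb, hba⟩ := mem_filter.mp hb
  have hb' := mem_antidiagonal.mp hb
  exact coeff_mul_congr (coeff_mul_congr (fun _ _ ↦ rfl) fun k hk ↦ hE k hk _)
    (fun k hk ↦ hP k hk _ (by omega)) m hm

end GeneratingFunction

/-! ### Power sums and MO series in terms of Eisenstein series. -/

section Quasimodularity

open scoped PowerSeries ArithmeticFunction.sigma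
open Finset EisensteinSeries ModularForm UpperHalfPlane

lemma MOSeries_zero : MOSeries 0 = 1 := by
  ext n
  obtain ⟨s, hs⟩ := exists_coeff_esymm_eq n
  rw [MOSeries, PowerSeries.coeff_mk, ← hs s subset_rfl 0]
  simp

/-- The right side is an odd polynomial in m; this is why only σ_k with odd k occur in the power
sums. -/
lemma factorial_mul_choose_eq_prod (r m : ℕ) :
    ((2 * r + 1).factorial : ℂ) * ((m + r).choose (2 * r + 1) : ℂ) =
      m * ∏ i ∈ range r, ((m : ℂ) ^ 2 - ((i : ℂ) + 1) ^ 2) := by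
  induction r with
  | zero => simp
  | succ r ih =>
    rw [prod_range_succ, ← mul_assoc, ← ih]
    have h1 : (m + (r + 1)).choose (2 * (r + 1) + 1) * (2 * r + 3) * (2 * r + 2) =
        (m + r).choose (2 * r + 1) * (m + r + 1) * (m - (r + 1)) := by
      have e1 := Nat.add_one_mul_choose_eq (m + r) (2 * r + 2)
      have e2 := Nat.choose_succ_right_eq (m + r) (2 * r + 1)
      rw [show m + (r + 1) = m + r + 1 by ring, show 2 * (r + 1) + 1 = 2 * r + 2 + 1 by ring,
        show 2 * r + 3 = 2 * r + 2 + 1 by ring, ← e1, mul_assoc, e2,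
        show m + r - (2 * r + 1) = m - (r + 1) by omega]
      ring
    have h2 : ((m + (r + 1)).choose (2 * (r + 1) + 1) : ℂ) * (2 * r + 3) * (2 * r + 2) =
        ((m + r).choose (2 * r + 1) : ℂ) * (m + r + 1) * (m - (r + 1)) := by
      -- The truncated subtraction in `h1` casts correctly only when r + 1 ≤ m; otherwise both
      -- binomial coefficients vanish.
      rcases le_or_gt (r + 1) m with h | h
      · have := congrArg (Nat.cast : ℕ → ℂ) h1
        push_cast [Nat.cast_sub h] at this
        exact this
      · rw [Nat.choose_eq_zero_of_lt (by omega : m + (r + 1) < 2 * (r + 1) + 1),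
          Nat.choose_eq_zero_of_lt (by omega : m + r < 2 * r + 1)]
        simp
    rw [show 2 * (r + 1) + 1 = 2 * r + 1 + 1 + 1 by ring, Nat.factorial_succ, Nat.factorial_succ]
    rw [show 2 * (r + 1) + 1 = 2 * r + 1 + 1 + 1 by ring] at h2
    push_cast
    linear_combination ((2 * r + 1).factorial : ℂ) * h2

lemma powerSumSeries_one : powerSumSeries 1 = sigmaSeries 1 := by
  ext n
  simp [powerSumSeries, sigmaSeries, ArithmeticFunction.sigma_apply]

lemma powerSumSeries_two :
    powerSumSeries 2 = (1 / 6 : ℂ) • (sigmaSeries 3 - sigmaSeries 1) := by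
  ext n
  simp only [powerSumSeries, sigmaSeries, ArithmeticFunction.sigma_apply, PowerSeries.coeff_mk,
    PowerSeries.coeff_smul, map_sub, Nat.cast_sum, smul_eq_mul, mul_sum, ← sum_sub_distrib]
  refine sum_congr rfl fun d _ ↦ ?_
  have := factorial_mul_choose_eq_prod 1 d
  norm_num [Nat.factorial, prod_range_succ] at this ⊢
  linear_combination (1 / 6) * this

lemma powerSumSeries_three : powerSumSeries 3 =
    (1 / 120 : ℂ) • (sigmaSeries 5 - (5 : ℂ) • sigmaSeries 3 + (4 : ℂ) • sigmaSeries 1) := by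
  ext n
  simp only [powerSumSeries, sigmaSeries, ArithmeticFunction.sigma_apply, PowerSeries.coeff_mk,
    PowerSeries.coeff_smul, map_sub, map_add, Nat.cast_sum, smul_eq_mul, mul_sum, ← sum_add_distrib,
    ← sum_sub_distrib]
  refine sum_congr rfl fun d _ ↦ ?_
  have := factorial_mul_choose_eq_prod 2 d
  norm_num [Nat.factorial, prod_range_succ] at this ⊢
  linear_combination (1 / 120) * this

lemma powerSumSeries_four : powerSumSeries 4 =
    (1 / 5040 : ℂ) • (sigmaSeries 7 - (14 : ℂ) • sigmaSeries 5 + (49 : ℂ) • sigmaSeries 3 -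
      (36 : ℂ) • sigmaSeries 1) := by
  ext n
  simp only [powerSumSeries, sigmaSeries, ArithmeticFunction.sigma_apply, PowerSeries.coeff_mk,
    PowerSeries.coeff_smul, map_sub, map_add, Nat.cast_sum, smul_eq_mul, mul_sum, ← sum_add_distrib,
    ← sum_sub_distrib]
  refine sum_congr rfl fun d _ ↦ ?_
  have := factorial_mul_choose_eq_prod 3 d
  norm_num [Nat.factorial, prod_range_succ] at this ⊢
  linear_combination (1 / 5040) * this

lemma powerSumSeries_five : powerSumSeries 5 =
    (1 / 362880 : ℂ) • (sigmaSeries 9 - (30 : ℂ) • sigmaSeries 7 + (273 : ℂ) • sigmaSeries 5 -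
      (820 : ℂ) • sigmaSeries 3 + (576 : ℂ) • sigmaSeries 1) := by
  ext n
  simp only [powerSumSeries, sigmaSeries, ArithmeticFunction.sigma_apply, PowerSeries.coeff_mk,
    PowerSeries.coeff_smul, map_sub, map_add, Nat.cast_sum, smul_eq_mul, mul_sum, ← sum_add_distrib,
    ← sum_sub_distrib]
  refine sum_congr rfl fun d _ ↦ ?_
  have := factorial_mul_choose_eq_prod 4 d
  norm_num [Nat.factorial, prod_range_succ] at this ⊢
  linear_combination (1 / 362880) * this

lemma MOSeries_eq_smul {a : ℕ} (ha : a ≠ 0) : MOSeries a = (1 / a : ℂ) • ((-1) ^ (a + 1) *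
    ∑ i ∈ range a, (-1) ^ i * MOSeries i * powerSumSeries (a - i)) := by
  have ha' : (a : ℂ) ≠ 0 := Nat.cast_ne_zero.mpr ha
  have h := mul_MOSeries a
  rw [sum_filter, Nat.sum_antidiagonal_eq_sum_range_succ
    (fun i j ↦ if i < a then (-1) ^ i * MOSeries i * powerSumSeries j else 0) a,
    sum_range_succ, if_neg (lt_irrefl a), add_zero,
    sum_congr rfl fun i hi ↦ if_pos (mem_range.mp hi)] at h
  rw [← h, ← nsmul_eq_mul, ← Nat.cast_smul_eq_nsmul ℂ, smul_smul, one_div_mul_cancel ha', one_smul]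

lemma MOSeries_one : MOSeries 1 = powerSumSeries 1 := by
  rw [MOSeries_eq_smul one_ne_zero]
  simp [MOSeries_zero]

lemma MOSeries_two : MOSeries 2 =
    (1 / 2 : ℂ) • (MOSeries 1 * powerSumSeries 1 - powerSumSeries 2) := by
  rw [MOSeries_eq_smul two_ne_zero]
  simp only [sum_range_succ, range_zero, sum_empty, MOSeries_zero, Nat.reduceSub, Nat.cast_ofNat]
  ring_nf

lemma MOSeries_three : MOSeries 3 = (1 / 3 : ℂ) • (MOSeries 2 * powerSumSeries 1 -
    MOSeries 1 * powerSumSeries 2 + powerSumSeries 3) := by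
  rw [MOSeries_eq_smul three_ne_zero]
  simp only [sum_range_succ, range_zero, sum_empty, MOSeries_zero, Nat.reduceSub, Nat.cast_ofNat]
  ring_nf

lemma MOSeries_four : MOSeries 4 = (1 / 4 : ℂ) • (MOSeries 3 * powerSumSeries 1 -
    MOSeries 2 * powerSumSeries 2 + MOSeries 1 * powerSumSeries 3 - powerSumSeries 4) := by
  rw [MOSeries_eq_smul four_ne_zero]
  simp only [sum_range_succ, range_zero, sum_empty, MOSeries_zero, Nat.reduceSub, Nat.cast_ofNat]
  ring_nf

lemma MOSeries_five : MOSeries 5 = (1 / 5 : ℂ) • (MOSeries 4 * powerSumSeries 1 -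
    MOSeries 3 * powerSumSeries 2 + MOSeries 2 * powerSumSeries 3 - MOSeries 1 * powerSumSeries 4 +
    powerSumSeries 5) := by
  rw [MOSeries_eq_smul (by norm_num)]
  simp only [sum_range_succ, range_zero, sum_empty, MOSeries_zero, Nat.reduceSub, Nat.cast_ofNat]
  ring_nf

lemma sigmaSeries_one_eq : sigmaSeries 1 = (1 / 24 : ℂ) • (1 - qExpansion 1 E2) := by
  rw [qExpansion_E2]
  module

lemma sigmaSeries_three_eq : sigmaSeries 3 = (1 / 240 : ℂ) • (qExpansion 1 E₄ - 1) := by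
  rw [qExpansion_E _ ⟨2, rfl⟩, show bernoulli 4 = -1 / 30 by decide +kernel]
  norm_num
  module

lemma sigmaSeries_five_eq : sigmaSeries 5 = (1 / 504 : ℂ) • (1 - qExpansion 1 E₆) := by
  rw [qExpansion_E _ ⟨3, rfl⟩, show bernoulli 6 = 1 / 42 by decide +kernel]
  norm_num
  module

lemma sigmaSeries_seven_eq :
    sigmaSeries 7 = (1 / 480 : ℂ) • (qExpansion 1 E₄ * qExpansion 1 E₄ - 1) := by
  rw [← E8_eq, qExpansion_E _ ⟨4, rfl⟩, show bernoulli 8 = -1 / 30 by decide +kernel]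
  norm_num
  module

lemma sigmaSeries_nine_eq :
    sigmaSeries 9 = (1 / 264 : ℂ) • (1 - qExpansion 1 E₄ * qExpansion 1 E₆) := by
  rw [← E10_eq, qExpansion_E _ ⟨5, rfl⟩, show bernoulli 10 = 5 / 66 by decide +kernel]
  norm_num
  module

end Quasimodularity

/-! ### Decomposition into derivatives of divisor sum series. -/

section Quasimodularity

open scoped PowerSeries ArithmeticFunction.sigma
open Finset EisensteinSeries ModularForm UpperHalfPlane

/-- In a differential algebra with Ramanujan's differential equations, the elementary symmetric
functions `eₐ` with the power sums `pᵣ` are linear combinations of derivatives of the series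
`sₖ`. -/
lemma esymm_eq_of_ramanujan {K A : Type*} [Field K] [CharZero K] [CommRing A] [Algebra K A]
    (θ : Derivation K A A) {P Q R s₁ s₃ s₅ s₇ s₉ p₁ p₂ p₃ p₄ p₅ e₁ e₂ e₃ e₄ e₅ : A}
    (hP : θ P = (1 / 12 : K) • (P * P - Q)) (hQ : θ Q = (1 / 3 : K) • (P * Q - R))
    (hR : θ R = (1 / 2 : K) • (P * R - Q * Q))
    (hs₁ : s₁ = (1 / 24 : K) • (1 - P)) (hs₃ : s₃ = (1 / 240 : K) • (Q - 1))
    (hs₅ : s₅ = (1 / 504 : K) • (1 - R)) (hs₇ : s₇ = (1 / 480 : K) • (Q * Q - 1))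
    (hs₉ : s₉ = (1 / 264 : K) • (1 - Q * R))
    (hp₁ : p₁ = s₁) (hp₂ : p₂ = (1 / 6 : K) • (s₃ - s₁))
    (hp₃ : p₃ = (1 / 120 : K) • (s₅ - (5 : K) • s₃ + (4 : K) • s₁))
    (hp₄ : p₄ = (1 / 5040 : K) • (s₇ - (14 : K) • s₅ + (49 : K) • s₃ - (36 : K) • s₁))
    (hp₅ : p₅ = (1 / 362880 : K) •
      (s₉ - (30 : K) • s₇ + (273 : K) • s₅ - (820 : K) • s₃ + (576 : K) • s₁))
    (he₁ : e₁ = p₁) (he₂ : e₂ = (1 / 2 : K) • (e₁ * p₁ - p₂))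
    (he₃ : e₃ = (1 / 3 : K) • (e₂ * p₁ - e₁ * p₂ + p₃))
    (he₄ : e₄ = (1 / 4 : K) • (e₃ * p₁ - e₂ * p₂ + e₁ * p₃ - p₄))
    (he₅ : e₅ = (1 / 5 : K) • (e₄ * p₁ - e₃ * p₂ + e₂ * p₃ - e₁ * p₄ + p₅)) :
    (8 : K) • e₂ = s₁ - (2 : K) • θ s₁ + s₃ ∧
    (1920 : K) • e₃ = (37 : K) • s₁ - (100 : K) • θ s₁ + (40 : K) • θ (θ s₁) +
      (50 : K) • s₃ - (30 : K) • θ s₃ + (3 : K) • s₅ ∧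
    (967680 : K) • e₄ = (3229 : K) • s₁ - (9870 : K) • θ s₁ + (5880 : K) • θ (θ s₁) -
      (840 : K) • θ (θ (θ s₁)) + (4935 : K) • s₃ - (4410 : K) • θ s₃ + (756 : K) • θ (θ s₃) +
      (441 : K) • s₅ - (126 : K) • θ s₅ + (5 : K) • s₇ ∧
    (154828800 : K) • e₅ = (96111 : K) • s₁ - (314200 : K) • θ s₁ + (223440 : K) • θ (θ s₁) -
      (50400 : K) • θ (θ (θ s₁)) + (3360 : K) • θ (θ (θ (θ s₁))) + (157100 : K) • s₃ -
      (167580 : K) • θ s₃ + (45360 : K) • θ (θ s₃) - (3360 : K) • θ (θ (θ s₃)) +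
      (16758 : K) • s₅ - (7560 : K) • θ s₅ + (720 : K) • θ (θ s₅) + (300 : K) • s₇ -
      (50 : K) • θ s₇ + s₉ := by
  subst hs₁ hs₃ hs₅ hs₇ hs₉ hp₁ hp₂ hp₃ hp₄ hp₅ he₁ he₂ he₃ he₄ he₅
  simp only [map_sub, map_add, map_zero, Derivation.map_smul, Derivation.leibniz, smul_eq_mul,
    Derivation.map_one_eq_zero, hP, hQ, hR]
  -- Everything is now a polynomial in P, Q, R, and both sides agree as such.
  refine ⟨?_, ?_, ?_, ?_⟩ <;> algebra

end Quasimodularity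

/-! ### Congruences from divisor sums. -/

section Congruences

open scoped ArithmeticFunction.sigma
open EisensteinSeries ModularForm UpperHalfPlane

/-- The numbers `macMahonN a * MO a n` are integral combinations of `nʲ σ_k(n)` with odd `k`. -/
lemma dvd_macMahonN_mul_MO {a : ℕ} (ha : a ∈ ({2, 3, 4, 5} : Set ℕ)) {M n : ℕ}
    (h : ∀ k, Odd k → M ∣ σ k n) : M ∣ macMahonN a * MO a n := by
  obtain ⟨h2, h3, h4, h5⟩ := esymm_eq_of_ramanujan eulerDeriv eulerDeriv_E2 eulerDeriv_E4
    eulerDeriv_E6 sigmaSeries_one_eq sigmaSeries_three_eq sigmaSeries_five_eq sigmaSeries_seven_eq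
    sigmaSeries_nine_eq powerSumSeries_one powerSumSeries_two powerSumSeries_three
    powerSumSeries_four powerSumSeries_five MOSeries_one MOSeries_two MOSeries_three
    MOSeries_four MOSeries_five
  have hσ (k : ℕ) (hk : Odd k) : (σ k n : ℤ) ≡ 0 [ZMOD M] :=
    Int.modEq_zero_iff_dvd.mpr (Int.natCast_dvd_natCast.mpr (h k hk))
  have hσ1 := hσ 1 (by decide)
  have hσ3 := hσ 3 (by decide)
  have hσ5 := hσ 5 (by decide)
  have hσ7 := hσ 7 (by decide)
  have hσ9 := hσ 9 (by decide)
  rw [← Int.natCast_dvd_natCast, ← Int.modEq_zero_iff_dvd]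
  have key {x : ℤ} {c₁ c₃ c₅ c₇ c₉ : ℤ}
      (hx : x = c₁ * σ 1 n + c₃ * σ 3 n + c₅ * σ 5 n + c₇ * σ 7 n + c₉ * σ 9 n) :
      x ≡ 0 [ZMOD M] := by
    rw [hx]
    simpa using ((((hσ1.mul_left c₁).add (hσ3.mul_left c₃)).add (hσ5.mul_left c₅)).add
      (hσ7.mul_left c₇)).add (hσ9.mul_left c₉)
  rcases ha with rfl | rfl | rfl | rfl
  · replace h2 := congrArg (PowerSeries.coeff n) h2
    simp only [map_add, map_sub, PowerSeries.coeff_smul, coeff_eulerDeriv, MOSeries, sigmaSeries,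
      PowerSeries.coeff_mk, smul_eq_mul] at h2
    -- Each θ multiplies the n-th coefficient by n, so the derivatives of one series collect into a
    -- polynomial in n.
    refine key (c₁ := 1 - 2 * n) (c₃ := 1) (c₅ := 0) (c₇ := 0) (c₉ := 0) ?_
    rw [← Int.cast_inj (α := ℂ)]
    push_cast [macMahonN]
    linear_combination h2
  · replace h3 := congrArg (PowerSeries.coeff n) h3
    simp only [map_add, map_sub, PowerSeries.coeff_smul, coeff_eulerDeriv, MOSeries, sigmaSeries,
      PowerSeries.coeff_mk, smul_eq_mul] at h3
    refine key (c₁ := 37 - 100 * n + 40 * n ^ 2) (c₃ := 50 - 30 * n) (c₅ := 3) (c₇ := 0)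
      (c₉ := 0) ?_
    rw [← Int.cast_inj (α := ℂ)]
    push_cast [macMahonN]
    linear_combination h3
  · replace h4 := congrArg (PowerSeries.coeff n) h4
    simp only [map_add, map_sub, PowerSeries.coeff_smul, coeff_eulerDeriv, MOSeries, sigmaSeries,
      PowerSeries.coeff_mk, smul_eq_mul] at h4
    refine key (c₁ := 3229 - 9870 * n + 5880 * n ^ 2 - 840 * n ^ 3)
      (c₃ := 4935 - 4410 * n + 756 * n ^ 2) (c₅ := 441 - 126 * n) (c₇ := 5) (c₉ := 0) ?_
    rw [← Int.cast_inj (α := ℂ)]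
    push_cast [macMahonN]
    linear_combination h4
  · replace h5 := congrArg (PowerSeries.coeff n) h5
    simp only [map_add, map_sub, PowerSeries.coeff_smul, coeff_eulerDeriv, MOSeries, sigmaSeries,
      PowerSeries.coeff_mk, smul_eq_mul] at h5
    refine key (c₁ := 96111 - 314200 * n + 223440 * n ^ 2 - 50400 * n ^ 3 + 3360 * n ^ 4)
      (c₃ := 157100 - 167580 * n + 45360 * n ^ 2 - 3360 * n ^ 3)
      (c₅ := 16758 - 7560 * n + 720 * n ^ 2) (c₇ := 300 - 50 * n) (c₉ := 1) ?_
    rw [← Int.cast_inj (α := ℂ)]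
    push_cast [macMahonN]
    linear_combination h5

/-- By multiplicativity σ_k(p) = 1 + p^k is a factor, and p + 1 divides it because k is odd. -/
lemma dvd_sigma_prime_mul {M p n k : ℕ} (hp : p.Prime) (hM : (p : ℤ) ≡ -1 [ZMOD M])
    (hn : n.Coprime p) (hk : Odd k) : M ∣ σ k (p * n) := by
  have h1 : M ∣ p + 1 := by
    have := (Int.modEq_iff_dvd.mp hM.symm)
    rw [sub_neg_eq_add] at this
    exact_mod_cast this
  rw [ArithmeticFunction.isMultiplicative_sigma.map_mul_of_coprime hn.symm]
  refine Dvd.dvd.mul_right (h1.trans ?_) _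
  rw [ArithmeticFunction.sigma_apply, hp.sum_divisors]
  simpa [add_comm] using hk.nat_add_dvd_pow_add_pow p 1

lemma macMahonN_ne_zero (a : ℕ) : macMahonN a ≠ 0 := by
  unfold macMahonN
  split <;> norm_num

lemma not_dvd_macMahonN {ℓ : ℕ} (hℓ : ℓ.Prime) (h : 11 ≤ ℓ) (a : ℕ) : ¬ ℓ ∣ macMahonN a := by
  have h' {q : ℕ} (hq : q.Prime) (hq' : q < 11) (k : ℕ) : ¬ ℓ ∣ q ^ k := fun hd ↦ by
    have := (Nat.prime_dvd_prime_iff_eq hℓ hq).mp (hℓ.dvd_of_dvd_pow hd)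
    omega
  have h2 := h' Nat.prime_two (by norm_num)
  have h3 := h' Nat.prime_three (by norm_num)
  have h5 := h' Nat.prime_five (by norm_num)
  have h7 := h' Nat.prime_seven (by norm_num)
  have h3' := h3 1
  have h5' := h5 1
  have h7' := h7 1
  rw [pow_one] at h3' h5' h7'
  unfold macMahonN
  split <;> simp only [hℓ.dvd_mul, h2, h3, h5, h3', h5', h7', hℓ.not_dvd_one, or_self,
    not_false_eq_true]

/-- Divisibility of `MO a (p * n)` by primes `ℓ` when `p ≡ -1` modulo a sufficiently high power
of `ℓ`. -/
lemma MO_prime_mul_modEq_zero {a : ℕ} (ha : a ∈ ({2, 3, 4, 5} : Set ℕ)) {ℓ p n : ℕ}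
    (hℓ : ℓ.Prime) (hp : p.Prime)
    (hpℓ : (p : ℤ) ≡ -1 [ZMOD (ℓ : ℤ) ^ (padicValNat ℓ (macMahonN a) + 1)])
    (hn : n.Coprime p) : MO a (p * n) ≡ 0 [MOD ℓ] := by
  have := Fact.mk hℓ
  have h := dvd_macMahonN_mul_MO ha fun k hk ↦
    dvd_sigma_prime_mul (M := ℓ ^ (padicValNat ℓ (macMahonN a) + 1)) hp (mod_cast hpℓ) hn hk
  rw [Nat.modEq_zero_iff_dvd]
  by_contra hd
  -- If ℓ did not divide the MO value, the whole power of ℓ would divide N_a, exceeding its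
  -- valuation.
  exact pow_succ_padicValNat_not_dvd (macMahonN_ne_zero a)
    ((((Nat.Prime.coprime_iff_not_dvd hℓ).mpr hd).pow_left _).dvd_of_dvd_mul_right h)

end Congruences

theorem mainTheorem8 (a : ℕ) (ha : a ∈ ({2, 3, 4, 5} : Set ℕ)) :
    (∀ ℓ ∈ ({2, 3, 5, 7} : Set ℕ), ∀ p : ℕ, p.Prime →
      (p : ℤ) ≡ -1 [ZMOD (ℓ : ℤ) ^ (padicValNat ℓ (macMahonN a) + 1)] →
      ∀ n : ℕ, n.Coprime p → MO a (p * n) ≡ 0 [MOD ℓ]) ∧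
    (∀ ℓ : ℕ, ℓ.Prime → 11 ≤ ℓ → ∀ p : ℕ, p.Prime →
      (p : ℤ) ≡ -1 [ZMOD (ℓ : ℤ)] →
      ∀ n : ℕ, n.Coprime p → MO a (p * n) ≡ 0 [MOD ℓ]) := by
  refine ⟨fun ℓ hℓ p hp hpℓ n hn ↦ ?_, fun ℓ hℓ h11 p hp hpℓ n hn ↦ ?_⟩
  · have hℓ' : ℓ.Prime := by
      rcases hℓ with rfl | rfl | rfl | rfl <;> norm_num
    exact MO_prime_mul_modEq_zero ha hℓ' hp hpℓ hn
  · refine MO_prime_mul_modEq_zero ha hℓ hp ?_ hn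
    -- Here ord_ℓ(N_a) = 0, so the required modulus is ℓ itself.
    rwa [padicValNat.eq_zero_of_not_dvd (not_dvd_macMahonN hℓ h11 a), zero_add, pow_one]
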